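/- For $M\in\mathbb R^{p\times q}$, an SVD $M=U\Sigma V^\top$ means a compact one: $U,V$ have orthonormal columns and $\Sigma$ is diagonal with the positive singular values of $M$ in non-increasing order (so the columns of $V$ form an orthonormal basis of the row space of $M$); $M_k=U_k\Sigma_kV_k^\top$ is its truncation to the $k$ largest singular values. For a partition $\mathcal C=(C_1,\dots,C_k)$ of $\{1,\dots,p\}$ into $k$ (possibly empty) clusters, let $$f_{k\text{-means}}(M,\mathcal C)=\sum_{i=1}^k\min_{\mu\in\mathbb R^q}\sum_{j\in C_i}\|M_j-\mu\|_2^2,$$ where $M_j$ is the $j$-th row of $M$. The clustering $\mathcal C$ is $\beta$-approximate for $M$ if $f_{k\text{-means}}(M,\mathcal C)\le\beta\min_{\mathcal C'}f_{k\text{-means}}(M,\mathcal C')$; an $\alpha$-approximation algorithm of $k$-means is an algorithm whose output on every input matrix is an $\alpha$-approximate clustering. The algorithm sketch-kmeans, run with an algorithm $\mathcal A$ on $A\in\mathbb R^{n\times d}$ and a sketch $S\in\mathbb R^{m\times n}$, computes an SVD $SA=U\Sigma V^\top$ and returns the clustering $\mathcal A(AV)$. **Theorem.** There is an absolute constant $K>0$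 such that the following holds for all $k\ge1$, $\alpha\ge1$, $\eta\ge0$. Let $A\in\mathbb R^{n\times d}$, and let $S\in\mathbb R^{m\times n}$ satisfy $$\|A-AVV^\top\|_2^2\le\frac{\eta}{k}\,\|A-A_k\|_F^2,\qquad\text{where } SA=U\Sigma V^\top \text{ is an SVD},$$ with $\|\cdot\|_2$ the spectral norm and $\|\cdot\|_F$ the Frobenius norm. Let $\overline S$ be any matrix obtained from $S$ by adding rows. Then, for every $\alpha$-approximation algorithm $\mathcal A$ of $k$-means, the clustering returned by sketch-kmeans with $\mathcal A$ on $A$ and $\overline S$ is an $\alpha(1+K\eta)$-approximate $k$-means clustering of $A$. -/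

import Mathlib

open scoped Matrix

noncomputable section

/-- The spectral norm `‖M‖₂` (operator norm for the Euclidean norms). -/
def specNorm {n d : ℕ} (M : Matrix (Fin n) (Fin d) ℝ) : ℝ :=
  Matrix.instL2OpNormedAddCommGroup.toNorm.norm M

/-- The Frobenius norm `‖M‖_F`. -/
def frobNorm {n d : ℕ} (M : Matrix (Fin n) (Fin d) ℝ) : ℝ :=
  Matrix.frobeniusNormedAddCommGroup.toNorm.norm M

/-- `M = U Σ Vᵀ` is a (compact) singular value decomposition of `M`: the columns of `U` and of `V`
are orthonormal and `Σ` is the square diagonal matrix of the positive singular values `σ`, in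
non-increasing order. In particular the columns of `V` are an orthonormal basis of the row space
of `M`. -/
structure IsSVD {n d r : ℕ} (M : Matrix (Fin n) (Fin d) ℝ)
    (U : Matrix (Fin n) (Fin r) ℝ) (σ : Fin r → ℝ) (V : Matrix (Fin d) (Fin r) ℝ) : Prop where
  left_orthonormal : Uᵀ * U = 1
  right_orthonormal : Vᵀ * V = 1
  pos : ∀ i, 0 < σ i
  antitone : Antitone σ
  eq : M = U * Matrix.diagonal σ * Vᵀ

/-- The truncation `U_k Σ_k V_kᵀ` of `U Σ Vᵀ` to its first `k` singular values. -/
def truncSVD {n d r : ℕ} (k : ℕ) (U : Matrix (Fin n) (Fin r) ℝ) (σ : Fin r → ℝ)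
    (V : Matrix (Fin d) (Fin r) ℝ) : Matrix (Fin n) (Fin d) ℝ :=
  U * Matrix.diagonal (fun i : Fin r => if (i : ℕ) < k then σ i else 0) * Vᵀ

/-- The `k`-means cost of the clustering `c` of the rows of `A`; row `j` lies in cluster `c j`
(clusters may be empty): `∑ᵢ min_μ ∑_{j in cluster i} ‖A_j - μ‖²`. -/
def kMeansCost {n d k : ℕ} (A : Matrix (Fin n) (Fin d) ℝ) (c : Fin n → Fin k) : ℝ :=
  ∑ i : Fin k, ⨅ μ : EuclideanSpace ℝ (Fin d),
    ∑ j : Fin n with c j = i, ‖WithLp.toLp 2 (A j) - μ‖ ^ 2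

/-- The optimal `k`-means cost (a minimum over finitely many clusterings). -/
def kMeansOpt {n d : ℕ} (k : ℕ) (A : Matrix (Fin n) (Fin d) ℝ) : ℝ :=
  ⨅ c : Fin n → Fin k, kMeansCost A c

/-- `c` is an `α`-approximate `k`-means clustering of the rows of `A`. -/
def IsKMeansApprox {n d k : ℕ} (α : ℝ) (A : Matrix (Fin n) (Fin d) ℝ) (c : Fin n → Fin k) : Prop :=
  kMeansCost A c ≤ α * kMeansOpt k A

/-- A procedure which takes a point set (the rows of a matrix, in any dimension) and returns a
clustering with `k` clusters. It may make arbitrary (nondeterministic) choices, so it is given by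
the set of its possible outputs on each input; a deterministic one has one output per input. -/
abbrev ClusteringAlgorithm (k : ℕ) : Type :=
  (n d : ℕ) → Matrix (Fin n) (Fin d) ℝ → Set (Fin n → Fin k)

/-- `alg` is an `α`-approximation algorithm of `k`-means. -/
def IsKMeansApproxAlgorithm {k : ℕ} (α : ℝ) (alg : ClusteringAlgorithm k) : Prop :=
  ∀ (n d : ℕ) (A : Matrix (Fin n) (Fin d) ℝ), ∀ c ∈ alg n d A, IsKMeansApprox α A c

/-- The algorithm sketch-kmeans: compute an SVD `S A = U Σ Vᵀ` and return the output of `alg`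
on `A V`. The elements are the possible outputs, over all choices of the SVD. -/
def sketchKMeans {m n d k : ℕ} (alg : ClusteringAlgorithm k) (A : Matrix (Fin n) (Fin d) ℝ)
    (S : Matrix (Fin m) (Fin n) ℝ) : Set (Fin n → Fin k) :=
  {c | ∃ (r : ℕ) (U : Matrix (Fin m) (Fin r) ℝ) (σ : Fin r → ℝ) (V : Matrix (Fin d) (Fin r) ℝ),
    IsSVD (S * A) U σ V ∧ c ∈ alg n r (A * V)}

/-- `S'` arises from `S` by adding rows (at arbitrary positions). -/
def IsRowExtension {m m' n : ℕ} (S : Matrix (Fin m) (Fin n) ℝ) (S' : Matrix (Fin m') (Fin n) ℝ) :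
    Prop :=
  ∃ f : Fin m ↪ Fin m', ∀ i, S' (f i) = S i

end

/-! With `X` the normalized indicator of a clustering, its cost on `M` is `‖M‖_F² - ‖X M‖_F²`
(`kMeansCost_eq`). Pythagoras then splits the cost on `A` into the cost on `A V'`, where the
algorithm is `α`-approximate, and the cost on the residual `E = A - A V' V'ᵀ`. On `E` the choice of
clustering hardly matters: every cost lies between `‖E‖_F² - k ‖E‖₂²` and `‖E‖_F²`, since `X` has
`k` rows of norm at most 1. Extra sketch rows only shrink `‖E‖₂` (`specNorm_residual_anti`), so by
hypothesis the gap is at most `η ‖A - A_k‖_F²`. This is at most `η` times the optimal cost, because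
clustering is a constrained rank-`k` approximation (`frobSq_sub_truncSVD_le_kMeansCost`). -/

/-- The sum of the squares of the entries of a matrix. -/
noncomputable def frobSq {ι κ : Type*} [Fintype ι] [Fintype κ] (M : Matrix ι κ ℝ) : ℝ :=
  ∑ i, ∑ j, M i j ^ 2

section frobSq

variable {ι κ l : Type*} [Fintype ι] [Fintype κ] [Fintype l]

lemma frobSq_nonneg (M : Matrix ι κ ℝ) : 0 ≤ frobSq M :=
  Finset.sum_nonneg fun _ _ => Finset.sum_nonneg fun _ _ => sq_nonneg _

lemma frobSq_transpose (M : Matrix ι κ ℝ) : frobSq Mᵀ = frobSq M :=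
  Finset.sum_comm

lemma frobSq_eq_trace (M : Matrix ι κ ℝ) : frobSq M = (M * Mᵀ).trace := by
  simp [frobSq, Matrix.trace, Matrix.mul_apply, sq]

lemma frobSq_mul_transpose [DecidableEq l] (M : Matrix ι l ℝ) (V : Matrix κ l ℝ)
    (hV : Vᵀ * V = 1) : frobSq (M * Vᵀ) = frobSq M := by
  rw [frobSq_eq_trace, frobSq_eq_trace, Matrix.transpose_mul, Matrix.transpose_transpose,
    Matrix.mul_assoc, ← Matrix.mul_assoc Vᵀ, hV, Matrix.one_mul]

lemma frobSq_mul_left [DecidableEq l] (M : Matrix l ι ℝ) (U : Matrix κ l ℝ)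
    (hU : Uᵀ * U = 1) : frobSq (U * M) = frobSq M := by
  rw [← frobSq_transpose, Matrix.transpose_mul, frobSq_mul_transpose _ _ hU, frobSq_transpose]

/-- Pythagoras for the projection of the rows of `M` on the span of the columns of `V`. -/
lemma frobSq_mul_add_frobSq_sub [DecidableEq l] (M : Matrix ι κ ℝ) (V : Matrix κ l ℝ)
    (hV : Vᵀ * V = 1) : frobSq (M * V) + frobSq (M - M * V * Vᵀ) = frobSq M := by
  have h : M * V * Vᵀ * (M * V * Vᵀ)ᵀ = M * V * (M * V)ᵀ := by
    rw [Matrix.transpose_mul _ Vᵀ, Matrix.transpose_transpose, Matrix.mul_assoc (M * V),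
      ← Matrix.mul_assoc Vᵀ, hV, Matrix.one_mul]
  have h1 : M * (M * V * Vᵀ)ᵀ = M * V * (M * V)ᵀ := by
    simp only [Matrix.transpose_mul, Matrix.transpose_transpose, Matrix.mul_assoc]
  have h2 : M * V * Vᵀ * Mᵀ = M * V * (M * V)ᵀ := by
    simp only [Matrix.transpose_mul, Matrix.mul_assoc]
  rw [frobSq_eq_trace, frobSq_eq_trace, frobSq_eq_trace, Matrix.transpose_sub, Matrix.sub_mul,
    Matrix.mul_sub, Matrix.mul_sub, h, h1, h2]
  simp

lemma frobSq_mul_le [DecidableEq l] (M : Matrix ι κ ℝ) (V : Matrix κ l ℝ)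
    (hV : Vᵀ * V = 1) : frobSq (M * V) ≤ frobSq M := by
  linarith [frobSq_mul_add_frobSq_sub M V hV, frobSq_nonneg (M - M * V * Vᵀ)]

lemma frobSq_mul_diagonal [DecidableEq κ] (M : Matrix ι κ ℝ) (σ : κ → ℝ) :
    frobSq (M * Matrix.diagonal σ) = ∑ j, σ j ^ 2 * ∑ i, M i j ^ 2 := by
  unfold frobSq
  rw [Finset.sum_comm]
  simp only [Matrix.mul_diagonal, mul_pow, Finset.mul_sum]
  simp only [mul_comm]

lemma frobSq_diagonal [DecidableEq κ] (σ : κ → ℝ) :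
    frobSq (Matrix.diagonal σ) = ∑ j, σ j ^ 2 := by
  unfold frobSq
  refine Finset.sum_congr rfl fun i _ => ?_
  rw [Finset.sum_eq_single i]
  · simp
  · intro j _ hj
    simp [Matrix.diagonal_apply_ne' _ hj]
  · simp

end frobSq

lemma frobNorm_sq {n d : ℕ} (M : Matrix (Fin n) (Fin d) ℝ) : frobNorm M ^ 2 = frobSq M := by
  have h : frobNorm M = (∑ i, ∑ j, ‖M i j‖ ^ (2 : ℝ)) ^ (1 / 2 : ℝ) := Matrix.frobenius_norm_def M
  have h' : (∑ i, ∑ j, ‖M i j‖ ^ (2 : ℝ)) = frobSq M := by simp [frobSq]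
  rw [h, h', ← Real.sqrt_eq_rpow, Real.sq_sqrt (frobSq_nonneg M)]

/-! ### Spectral norm and the residual of the sketch -/

section specNorm

open scoped Matrix.Norms.L2Operator

lemma specNorm_nonneg {n d : ℕ} (M : Matrix (Fin n) (Fin d) ℝ) : 0 ≤ specNorm M :=
  norm_nonneg M

lemma sum_sq_mulVec_le {n d : ℕ} (M : Matrix (Fin n) (Fin d) ℝ) (x : Fin d → ℝ) :
    ∑ i, (M *ᵥ x) i ^ 2 ≤ specNorm M ^ 2 * ∑ j, x j ^ 2 := by
  have h := Matrix.l2_opNorm_mulVec M (WithLp.toLp 2 x)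
  have h2 := pow_le_pow_left₀ (norm_nonneg _) h 2
  rw [mul_pow, EuclideanSpace.norm_sq_eq, EuclideanSpace.norm_sq_eq] at h2
  simpa [specNorm] using h2

lemma specNorm_transpose {n d : ℕ} (M : Matrix (Fin n) (Fin d) ℝ) :
    specNorm Mᵀ = specNorm M := by
  have h := Matrix.l2_opNorm_conjTranspose M
  rwa [Matrix.conjTranspose_eq_transpose_of_trivial] at h

lemma specNorm_mul_le_of_isProj {n d : ℕ} (M : Matrix (Fin n) (Fin d) ℝ)
    (P : Matrix (Fin d) (Fin d) ℝ) (hP : Pᵀ = P) (hPP : P * P = P) :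
    specNorm (M * P) ≤ specNorm M := by
  have h := Matrix.l2_opNorm_conjTranspose_mul_self P
  rw [Matrix.conjTranspose_eq_transpose_of_trivial, hP, hPP] at h
  -- `h` now reads `‖P‖ = ‖P‖ * ‖P‖`.
  have h1 : ‖P‖ ≤ 1 := by
    by_contra! hc
    nlinarith
  exact (Matrix.l2_opNorm_mul M P).trans (mul_le_of_le_one_right (norm_nonneg M) h1)

end specNorm

/-- Enlarging the row space of the sketch does not increase the spectral error. -/
lemma specNorm_residual_anti {m m' n d r r' : ℕ} {A : Matrix (Fin n) (Fin d) ℝ}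
    {S : Matrix (Fin m) (Fin n) ℝ} {S' : Matrix (Fin m') (Fin n) ℝ}
    {U : Matrix (Fin m) (Fin r) ℝ} {σ : Fin r → ℝ} {V : Matrix (Fin d) (Fin r) ℝ}
    {U' : Matrix (Fin m') (Fin r') ℝ} {σ' : Fin r' → ℝ} {V' : Matrix (Fin d) (Fin r') ℝ}
    (h : IsSVD (S * A) U σ V) (h' : IsSVD (S' * A) U' σ' V') (hS : IsRowExtension S S') :
    specNorm (A - A * V' * V'ᵀ) ≤ specNorm (A - A * V * Vᵀ) := by
  set P : Matrix (Fin d) (Fin d) ℝ := 1 - V' * V'ᵀ with hPdef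
  have hVP : V'ᵀ * P = 0 := by
    rw [hPdef, Matrix.mul_sub, ← Matrix.mul_assoc, h'.right_orthonormal]
    simp
  have hPt : Pᵀ = P := by simp [hPdef]
  have hPP : P * P = P := by
    conv_lhs => rw [hPdef]
    rw [Matrix.sub_mul, Matrix.mul_assoc, hVP]
    simp [hPdef]
  have hS'P : S' * (A * P) = 0 := by
    rw [← Matrix.mul_assoc, h'.eq, Matrix.mul_assoc, hVP, Matrix.mul_zero]
  have hSP : S * (A * P) = 0 := by
    obtain ⟨f, hf⟩ := hS
    ext i j
    have := congrFun (congrFun hS'P (f i)) j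
    rw [Matrix.mul_apply] at this ⊢
    simpa [hf] using this
  -- `U` cancels by orthonormality and `diagonal σ` by positivity of the singular values.
  have hVP2 : Vᵀ * P = 0 := by
    rw [← Matrix.mul_assoc, h.eq, Matrix.mul_assoc, Matrix.mul_assoc] at hSP
    have h1 : Matrix.diagonal σ * (Vᵀ * P) = 0 := by
      have := congrArg (Uᵀ * ·) hSP
      simpa only [← Matrix.mul_assoc, h.left_orthonormal, Matrix.one_mul, Matrix.mul_zero]
        using this
    ext i j
    have h2 := congrFun (congrFun h1 i) j
    rw [Matrix.diagonal_mul] at h2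
    simpa [(h.pos i).ne'] using h2
  have key : A - A * V' * V'ᵀ = (A - A * V * Vᵀ) * P := by
    rw [Matrix.sub_mul, Matrix.mul_assoc (A * V), hVP2, hPdef, Matrix.mul_sub, Matrix.mul_one,
      ← Matrix.mul_assoc]
    simp
  rw [key]
  exact specNorm_mul_le_of_isProj _ _ hPt hPP

/-! ### The k-means cost in matrix form -/

/-- The normalized cluster indicators, transposed: row `i` is the indicator of cluster `i` divided
by the square root of its size. -/
noncomputable def clusterIndicator {n k : ℕ} (c : Fin n → Fin k) : Matrix (Fin k) (Fin n) ℝ :=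
  fun i j => if c j = i then (√(Finset.card {j | c j = i} : ℝ))⁻¹ else 0

/-- Equality fails only for an empty cluster, whose row is zero. -/
lemma sum_clusterIndicator_sq_le {n k : ℕ} (c : Fin n → Fin k) (i : Fin k) :
    ∑ j, clusterIndicator c i j ^ 2 ≤ 1 := by
  simp only [clusterIndicator, ite_pow, inv_pow, Real.sq_sqrt (Nat.cast_nonneg _)]
  rw [zero_pow two_ne_zero, ← Finset.sum_filter, Finset.sum_const, nsmul_eq_mul]
  exact mul_inv_le_one

lemma clusterIndicator_mul_apply_sq {n d k : ℕ} (c : Fin n → Fin k)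
    (A : Matrix (Fin n) (Fin d) ℝ) (i : Fin k) (l : Fin d) :
    (clusterIndicator c * A) i l ^ 2 =
      (∑ j with c j = i, A j l) ^ 2 / (Finset.card {j | c j = i} : ℝ) := by
  simp only [Matrix.mul_apply, clusterIndicator, ite_mul, zero_mul]
  rw [← Finset.sum_filter, ← Finset.mul_sum, mul_pow, inv_pow, Real.sq_sqrt (Nat.cast_nonneg _),
    div_eq_inv_mul]

/-- The cost of one cluster is the sum of squares minus the contribution of its mean. -/
lemma iInf_sum_norm_sub_sq {ι : Type*} {d : ℕ} (s : Finset ι) (a : ι → Fin d → ℝ) :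
    ⨅ μ : EuclideanSpace ℝ (Fin d), ∑ j ∈ s, ‖WithLp.toLp 2 (a j) - μ‖ ^ 2 =
      ∑ l, (∑ j ∈ s, a j l ^ 2 - (∑ j ∈ s, a j l) ^ 2 / (s.card : ℝ)) := by
  rcases s.eq_empty_or_nonempty with rfl | hs
  · simp
  have hc : (0 : ℝ) < s.card := by exact_mod_cast hs.card_pos
  -- Completing the square around the mean, coordinate by coordinate.
  have key : ∀ μ : EuclideanSpace ℝ (Fin d), ∑ j ∈ s, ‖WithLp.toLp 2 (a j) - μ‖ ^ 2 =
      ∑ l, (∑ j ∈ s, a j l ^ 2 - (∑ j ∈ s, a j l) ^ 2 / (s.card : ℝ)) +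
        ∑ l, (s.card : ℝ) * (μ l - (∑ j ∈ s, a j l) / s.card) ^ 2 := by
    intro μ
    simp only [EuclideanSpace.norm_sq_eq, Real.norm_eq_abs, sq_abs, PiLp.sub_apply]
    rw [Finset.sum_comm, ← Finset.sum_add_distrib]
    refine Finset.sum_congr rfl fun l _ => ?_
    simp only [sub_sq, Finset.sum_add_distrib, Finset.sum_sub_distrib, Finset.sum_const,
      nsmul_eq_mul, ← Finset.sum_mul, ← Finset.mul_sum]
    field_simp
    ring
  apply le_antisymm
  · refine (ciInf_le ⟨0, ?_⟩ (WithLp.toLp 2 fun l => (∑ j ∈ s, a j l) / s.card)).trans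
      (le_of_eq ?_)
    · rintro _ ⟨μ, rfl⟩
      exact Finset.sum_nonneg fun _ _ => sq_nonneg _
    · rw [key]
      simp
  · refine le_ciInf fun μ => ?_
    rw [key]
    exact le_add_of_nonneg_right
      (Finset.sum_nonneg fun _ _ => mul_nonneg hc.le (sq_nonneg _))

lemma kMeansCost_eq {n d k : ℕ} (A : Matrix (Fin n) (Fin d) ℝ) (c : Fin n → Fin k) :
    kMeansCost A c = frobSq A - frobSq (clusterIndicator c * A) := by
  have hA : frobSq A = ∑ i, ∑ l, ∑ j with c j = i, A j l ^ 2 := by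
    rw [frobSq, ← Finset.sum_fiberwise Finset.univ c]
    exact Finset.sum_congr rfl fun i _ => Finset.sum_comm
  rw [hA, kMeansCost, frobSq, ← Finset.sum_sub_distrib]
  refine Finset.sum_congr rfl fun i _ => ?_
  refine (iInf_sum_norm_sub_sq _ fun j => A j).trans ?_
  rw [← Finset.sum_sub_distrib]
  simp only [clusterIndicator_mul_apply_sq]

lemma kMeansCost_nonneg {n d k : ℕ} (A : Matrix (Fin n) (Fin d) ℝ) (c : Fin n → Fin k) :
    0 ≤ kMeansCost A c :=
  Finset.sum_nonneg fun _ _ => Real.iInf_nonneg fun _ =>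
    Finset.sum_nonneg fun _ _ => sq_nonneg _

/-- The difference of the two sides is a cost, hence nonnegative. -/
lemma frobSq_clusterIndicator_mul_le {n d k : ℕ} (c : Fin n → Fin k)
    (A : Matrix (Fin n) (Fin d) ℝ) : frobSq (clusterIndicator c * A) ≤ frobSq A := by
  linarith [kMeansCost_eq A c, kMeansCost_nonneg A c]

lemma frobSq_clusterIndicator_mul_le_specNorm {n d k : ℕ} (c : Fin n → Fin k)
    (E : Matrix (Fin n) (Fin d) ℝ) :
    frobSq (clusterIndicator c * E) ≤ k * specNorm E ^ 2 := by
  have h : ∀ i : Fin k, ∑ l, (clusterIndicator c * E) i l ^ 2 ≤ specNorm E ^ 2 := by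
    intro i
    have h1 := sum_sq_mulVec_le Eᵀ (clusterIndicator c i)
    rw [specNorm_transpose, Matrix.mulVec_transpose] at h1
    exact h1.trans (mul_le_of_le_one_right (sq_nonneg _) (sum_clusterIndicator_sq_le c i))
  calc frobSq (clusterIndicator c * E) ≤ ∑ _i : Fin k, specNorm E ^ 2 :=
        Finset.sum_le_sum fun i _ => h i
    _ = k * specNorm E ^ 2 := by simp

/-! ### Comparison with the best rank-k approximation -/

/-- Weights in `[0, 1]` of total at most `k` pick up at most the `k` first terms of a
non-increasing nonnegative sequence. -/
lemma sum_mul_le_sum_first {s k : ℕ} (a w : Fin s → ℝ) (ha : Antitone a) (ha0 : ∀ j, 0 ≤ a j)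
    (hw0 : ∀ j, 0 ≤ w j) (hw1 : ∀ j, w j ≤ 1) (hw : ∑ j, w j ≤ k) :
    ∑ j, a j * w j ≤ ∑ j : Fin s, if (j : ℕ) < k then a j else 0 := by
  rcases le_or_gt s k with hsk | hsk
  · refine Finset.sum_le_sum fun j _ => ?_
    rw [if_pos (j.2.trans_le hsk)]
    exact mul_le_of_le_one_right (ha0 j) (hw1 j)
  -- The first omitted term `t` serves as a threshold: `(a j - t) * w j` is at most `a j - t` for `j
  -- < k` and at most 0 afterwards. After summing, `t ≥ 0` and `∑ w ≤ k` remove `t`.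
  · set t := a ⟨k, hsk⟩ with ht
    have hcard : ∑ j : Fin s, (if (j : ℕ) < k then (1 : ℝ) else 0) = k := by
      rw [Finset.sum_boole]
      congr 1
      have : (Finset.univ.filter fun j : Fin s => (j : ℕ) < k) = Finset.Iio ⟨k, hsk⟩ := by
        ext j
        simp [Fin.lt_def]
      rw [this, Fin.card_Iio]
    have h : ∀ j : Fin s, a j * w j - t * w j ≤
        (if (j : ℕ) < k then a j else 0) - t * (if (j : ℕ) < k then (1 : ℝ) else 0) := by
      intro j
      split_ifs with hj
      · have : t ≤ a j := ha (Fin.le_def.2 hj.le)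
        nlinarith [hw1 j]
      · have : a j ≤ t := ha (Fin.le_def.2 (not_lt.1 hj))
        nlinarith [hw0 j]
    have hsum := Finset.sum_le_sum fun j (_ : j ∈ Finset.univ) => h j
    rw [Finset.sum_sub_distrib, Finset.sum_sub_distrib, ← Finset.mul_sum, ← Finset.mul_sum,
      hcard] at hsum
    nlinarith [ha0 ⟨k, hsk⟩]

/-- The best rank-`k` approximation error is at most the cost of any clustering with `k`
clusters. -/
lemma frobSq_sub_truncSVD_le_kMeansCost {n d k s : ℕ} {A : Matrix (Fin n) (Fin d) ℝ}
    {U : Matrix (Fin n) (Fin s) ℝ} {σ : Fin s → ℝ} {V : Matrix (Fin d) (Fin s) ℝ}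
    (h : IsSVD A U σ V) (c : Fin n → Fin k) :
    frobSq (A - truncSVD k U σ V) ≤ kMeansCost A c := by
  set X := clusterIndicator c with hX
  -- `w j` is the share of `σ j ^ 2` captured by the clustering; truncation captures the first `k`
  -- in full.
  set w : Fin s → ℝ := fun j => ∑ i, (X * U) i j ^ 2 with hwdef
  have hA : frobSq A = ∑ j, σ j ^ 2 := by
    rw [h.eq, frobSq_mul_transpose _ _ h.right_orthonormal,
      frobSq_mul_left _ _ h.left_orthonormal, frobSq_diagonal]
  have hXA : frobSq (X * A) = ∑ j, σ j ^ 2 * w j := by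
    rw [h.eq, ← Matrix.mul_assoc, frobSq_mul_transpose _ _ h.right_orthonormal,
      ← Matrix.mul_assoc, frobSq_mul_diagonal]
  have hT : frobSq (A - truncSVD k U σ V) = ∑ j, σ j ^ 2 -
      ∑ j : Fin s, (if (j : ℕ) < k then σ j ^ 2 else 0) := by
    have : A - truncSVD k U σ V =
        U * Matrix.diagonal (fun j : Fin s => σ j - if (j : ℕ) < k then σ j else 0) * Vᵀ := by
      conv_lhs => rw [h.eq]
      rw [truncSVD, ← Matrix.sub_mul, ← Matrix.mul_sub, Matrix.diagonal_sub]
    rw [this, frobSq_mul_transpose _ _ h.right_orthonormal,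
      frobSq_mul_left _ _ h.left_orthonormal, frobSq_diagonal, ← Finset.sum_sub_distrib]
    refine Finset.sum_congr rfl fun j _ => ?_
    split_ifs <;> simp
  have hw1 : ∀ j, w j ≤ 1 := by
    intro j
    -- The unit column `j` of `U` is treated as a one-column data matrix.
    have h1 := frobSq_clusterIndicator_mul_le c (Matrix.of fun i (_ : Fin 1) => U i j)
    have h2 : ∑ i, U i j ^ 2 = 1 := by
      have := congrFun (congrFun h.left_orthonormal j) j
      simpa [Matrix.mul_apply, sq] using this
    simp only [frobSq, Finset.univ_unique, Finset.sum_singleton, Matrix.of_apply, h2] at h1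
    simpa [hwdef, Matrix.mul_apply] using h1
  have hwk : ∑ j, w j ≤ k := by
    calc ∑ j, w j = frobSq (X * U) := Finset.sum_comm
      _ ≤ frobSq X := frobSq_mul_le _ _ h.left_orthonormal
      _ ≤ ∑ _i : Fin k, (1 : ℝ) :=
        Finset.sum_le_sum fun i _ => sum_clusterIndicator_sq_le c i
      _ = k := by simp
  have hsum := sum_mul_le_sum_first (fun j => σ j ^ 2) w
    (fun i j hij => pow_le_pow_left₀ (h.pos j).le (h.antitone hij) 2)
    (fun j => sq_nonneg _) (fun j => Finset.sum_nonneg fun _ _ => sq_nonneg _) hw1 hwk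
  rw [kMeansCost_eq, hA, hXA, hT]
  linarith

/-- The cost of a clustering splits into the cost after projection and that of the residual. -/
lemma kMeansCost_eq_projection_add_residual {n d k r : ℕ} (A : Matrix (Fin n) (Fin d) ℝ)
    (V : Matrix (Fin d) (Fin r) ℝ) (hV : Vᵀ * V = 1) (c : Fin n → Fin k) :
    kMeansCost A c = kMeansCost (A * V) c + kMeansCost (A - A * V * Vᵀ) c := by
  have h1 := frobSq_mul_add_frobSq_sub A V hV
  have h2 := frobSq_mul_add_frobSq_sub (clusterIndicator c * A) V hV
  simp only [kMeansCost_eq, Matrix.mul_sub, ← Matrix.mul_assoc] at h1 h2 ⊢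
  linarith

theorem mainTheorem3 :
    ∃ K : ℝ, 0 < K ∧
      ∀ (m m' n d k r s : ℕ) (α η : ℝ)
        (A : Matrix (Fin n) (Fin d) ℝ)
        (S : Matrix (Fin m) (Fin n) ℝ) (S' : Matrix (Fin m') (Fin n) ℝ)
        (UA : Matrix (Fin n) (Fin s) ℝ) (σA : Fin s → ℝ) (VA : Matrix (Fin d) (Fin s) ℝ)
        (U : Matrix (Fin m) (Fin r) ℝ) (σ : Fin r → ℝ) (V : Matrix (Fin d) (Fin r) ℝ)
        (alg : ClusteringAlgorithm k),
        0 < k → 1 ≤ α → 0 ≤ η →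
        IsSVD A UA σA VA →
        IsSVD (S * A) U σ V →
        specNorm (A - A * V * Vᵀ) ^ 2 ≤ η / k * frobNorm (A - truncSVD k UA σA VA) ^ 2 →
        IsRowExtension S S' →
        IsKMeansApproxAlgorithm α alg →
        ∀ c ∈ sketchKMeans alg A S', IsKMeansApprox (α * (1 + K * η)) A c := by
  -- The only loss is the gap on the residual, so `K = 1` suffices.
  refine ⟨1, one_pos, ?_⟩
  intro m m' n d k r s α η A S S' UA σA VA U σ V alg hk hα hη hA hSVD hspec hS halg c hc
  obtain ⟨r', U', σ', V', hSVD', hcA⟩ := hc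
  have hapx : kMeansCost (A * V') c ≤ α * kMeansOpt k (A * V') := halg n r' (A * V') c hcA
  have : Nonempty (Fin n → Fin k) := ⟨c⟩
  obtain ⟨c₀, hc₀⟩ := exists_eq_ciInf_of_finite (f := fun c : Fin n → Fin k => kMeansCost A c)
  change kMeansCost A c ≤ α * (1 + 1 * η) * ⨅ c : Fin n → Fin k, kMeansCost A c
  rw [← hc₀]
  have hopt : kMeansOpt k (A * V') ≤ kMeansCost (A * V') c₀ :=
    ciInf_le (Set.finite_range _).bddBelow c₀
  set E := A - A * V' * V'ᵀ with hE
  have hEη : k * specNorm E ^ 2 ≤ η * kMeansCost A c₀ := by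
    have h1 : specNorm E ^ 2 ≤ specNorm (A - A * V * Vᵀ) ^ 2 :=
      pow_le_pow_left₀ (specNorm_nonneg E)
        (specNorm_residual_anti hSVD hSVD' hS) 2
    have hk0 : (0 : ℝ) < k := by exact_mod_cast hk
    calc k * specNorm E ^ 2 ≤ k * (η / k * frobNorm (A - truncSVD k UA σA VA) ^ 2) :=
          mul_le_mul_of_nonneg_left (h1.trans hspec) hk0.le
      _ = η * frobSq (A - truncSVD k UA σA VA) := by
          rw [frobNorm_sq]
          field_simp
      _ ≤ η * kMeansCost A c₀ :=
          mul_le_mul_of_nonneg_left (frobSq_sub_truncSVD_le_kMeansCost hA c₀) hη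
  have hc1 := kMeansCost_eq_projection_add_residual A V' hSVD'.right_orthonormal c
  have hc2 := kMeansCost_eq_projection_add_residual A V' hSVD'.right_orthonormal c₀
  rw [← hE] at hc1 hc2
  have hEc : kMeansCost E c ≤ frobSq E := by
    linarith [kMeansCost_eq E c, frobSq_nonneg (clusterIndicator c * E)]
  have hEc₀ : frobSq E ≤ kMeansCost E c₀ + η * kMeansCost A c₀ := by
    linarith [kMeansCost_eq E c₀, frobSq_clusterIndicator_mul_le_specNorm c₀ E]
  have hα0 : 0 ≤ α := by linarith
  -- The residual needs no factor `α`; `1 ≤ α` lets it share the factor of the projected part.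
  have hEα : frobSq E ≤ α * frobSq E := le_mul_of_one_le_left (frobSq_nonneg E) hα
  have h1 := mul_le_mul_of_nonneg_left hopt hα0
  have h2 := mul_le_mul_of_nonneg_left hEc₀ hα0
  calc kMeansCost A c ≤ α * kMeansCost (A * V') c₀ +
        α * (kMeansCost E c₀ + η * kMeansCost A c₀) := by linarith
    _ = α * (1 + 1 * η) * kMeansCost A c₀ := by
        rw [hc2]
        ring
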